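/- Let $q:\mathbb{R}\to\mathbb{C}$ be a $2\pi$-periodic function of class $C^2$ with mean value $\langle q\rangle=\frac{1}{2\pi}\int_0^{2\pi}q(\xi)\,d\xi=0$. For $\lambda\in\mathbb{C}$ let $v(x)=v(x;\lambda)$ be the solution of $-v''+q(x)v=\lambda v$ on $\mathbb{R}$ with $v(0;\lambda)=0$ and $v'(0;\lambda)=1$ (primes denote derivatives with respect to $x$). Then $\lambda\mapsto v(2\pi;\lambda)$ is an entire function, its zeros, counted with multiplicity, can be listed as an infinite sequence $\mu_1,\mu_2,\ldots$ with $|\mu_1|\le|\mu_2|\le\cdots$, and for every such listing $$\sum_{n=1}^{\infty}\left(\mu_n-\frac{n^2}{4}\right)=\lim_{n\to\infty}\sum_{j=1}^{n}\left(\mu_j-\frac{j^2}{4}\right)=-\frac{q(0)}{2}.$$ -/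

import Mathlib

open Filter Topology

noncomputable section

/-- `y` is a (classical) solution on the whole real line of `-y'' + q y = lam y`
with `y 0 = 0` and `y' 0 = 1`. -/
def IsSineSolution (q : ℝ → ℂ) (lam : ℂ) (y : ℝ → ℂ) : Prop :=
  ContDiff ℝ 2 y ∧
    (∀ x : ℝ, -deriv (deriv y) x + q x * y x = lam * y x) ∧
    y 0 = 0 ∧ deriv y 0 = 1

/-- `hillV q lam x` is `v(x; lam)`, where `v(·; lam)` is the solution of
`-v'' + q v = lam v` with `v(0) = 0`, `v'(0) = 1`; for continuous `q` it exists and is unique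
by the global existence and uniqueness theorem for linear equations. -/
def hillV (q : ℝ → ℂ) (lam : ℂ) : ℝ → ℂ :=
  Classical.epsilon (IsSineSolution q lam)

/-- The mean value `⟨q⟩` of `q` over a period. -/
def hillMean (q : ℝ → ℂ) : ℂ :=
  (1 / (2 * (Real.pi : ℂ))) * ∫ x in (0 : ℝ)..(2 * Real.pi), q x

/-- `μ 1, μ 2, …` is the list of all the zeros of the function `F`, each one listed as many
times as its multiplicity, in the order of nondecreasing modulus (the value `μ 0` is not used). -/
def EnumeratesZeros (F : ℂ → ℂ) (μ : ℕ → ℂ) : Prop :=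
  (∀ z : ℂ, {j : ℕ | 1 ≤ j ∧ μ j = z}.encard = analyticOrderAt F z) ∧
    ∀ i j : ℕ, 1 ≤ i → i ≤ j → ‖μ i‖ ≤ ‖μ j‖

end

/-! Write `lam = k ^ 2` and let `F`, `F₀` be the values at `2π` of the solutions for `q` and for the
zero potential, so that `F₀ = sin(2πk)/k`, with simple zeros exactly at `n²/4`, `n ≥ 1`. Two steps
of a large-`k` expansion, with `Q = ∫ q`, give `v = (1 + a/k²) sin(kx)/k - Q cos(kx)/(2k²) +
O(exp(|Im k| x)/|k|⁴)`. At `x = 2π` the zero mean kills `Q` and periodicity turns `a` into `q 0 / 2`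
(`hillV_asymptotic`).

On the circles `|lam| = r²`, `r = (N + 1/2)/2`, the sine is comparable with `exp(2π|Im k|)`
(`exp_abs_im_le_norm_sin`), hence `F/F₀ = 1 + q 0/(2 lam) + O(r⁻³)`. The weighted argument
principle, integrated by parts, gives for entire `w` that `2πi` times the difference of the sums of
`w` over the zeros of `F` and of `F₀` inside the circle equals `-∮ w' log(F/F₀)`
(`sum_zeros_sub_sum_zeros`). With `w = 1` both functions have `N` zeros there. With `w = z` the
difference is `-q 0/2 + O(1/r)`: the main term is the residue of `q 0/(2z)`, and the error `O(r⁻³)`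
is integrated over a length of order `r²`.

In any listing by modulus those `N` zeros are `μ 1, …, μ N` (`EnumeratesZeros.sum_eq`), so every
large partial sum is controlled, not merely a subsequence. -/

/-! ### Linear differential equations: existence, growth, variation of constants -/

/-- Picard series for the linear equation `y' = A y + f`. -/
noncomputable def picardTerm {E : Type*} [NormedAddCommGroup E] [NormedSpace ℝ E]
    (A : ℝ → E →L[ℝ] E) (f : ℝ → E) (y₀ : E) : ℕ → ℝ → E
  | 0 => fun x => y₀ + ∫ t in (0 : ℝ)..x, f t
  | n + 1 => fun x => ∫ t in (0 : ℝ)..x, A t (picardTerm A f y₀ n t)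

/-- On each bounded interval the `n`-th Picard term is `O((M|x|)^n / n!)`, so the series and its
termwise derivative converge uniformly there. This makes the solution global. -/
theorem exists_linear_ode {E : Type*} [NormedAddCommGroup E] [NormedSpace ℝ E] [CompleteSpace E]
    {A : ℝ → E →L[ℝ] E} (hA : Continuous A) {f : ℝ → E} (hf : Continuous f) (y₀ : E) :
    ∃ y : ℝ → E, y 0 = y₀ ∧ ∀ x, HasDerivAt y (A x (y x) + f x) x := by
  set Y := picardTerm A f y₀ with hY
  have hd0 : ∀ x, HasDerivAt (Y 0) (f x) x := fun x =>
    (hf.integral_hasStrictDerivAt 0 x).hasDerivAt.const_add y₀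
  have hYc : ∀ n, Continuous (Y n) := by
    intro n
    induction n with
    | zero => exact continuous_iff_continuousAt.2 fun x => (hd0 x).continuousAt
    | succ n ih =>
      have hg : Continuous fun t => A t (Y n t) := hA.clm_apply ih
      exact continuous_iff_continuousAt.2 fun x =>
        (hg.integral_hasStrictDerivAt 0 x).hasDerivAt.continuousAt
  have hg : ∀ n, Continuous fun t => A t (Y n t) := fun n => hA.clm_apply (hYc n)
  have hds : ∀ n x, HasDerivAt (Y (n + 1)) (A x (Y n x)) x := fun n x =>
    ((hg n).integral_hasStrictDerivAt 0 x).hasDerivAt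
  have h00 : Y 0 0 = y₀ := by simp [hY, picardTerm]
  have hs0 : ∀ n, Y (n + 1) 0 = 0 := fun n => by simp [hY, picardTerm]
  set g' : ℕ → ℝ → E := fun n => Nat.casesOn n f (fun m x => A x (Y m x)) with hg'
  have hd : ∀ n x, HasDerivAt (Y n) (g' n x) x := by
    intro n x
    cases n with
    | zero => exact hd0 x
    | succ n => exact hds n x
  have key : ∀ X : ℝ, ∃ M C D : ℝ, 0 ≤ M ∧ 0 ≤ C ∧
      (∀ x ∈ Set.Icc (-X) X, ‖A x‖ ≤ M ∧ ‖f x‖ ≤ D) ∧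
      ∀ n, ∀ x ∈ Set.Icc (-X) X, ‖Y n x‖ ≤ C * ((M * |x|) ^ n / n.factorial) := by
    intro X
    obtain ⟨M, hM⟩ := (isCompact_Icc (a := -X) (b := X)).exists_bound_of_continuousOn
      hA.continuousOn
    obtain ⟨D, hD⟩ := (isCompact_Icc (a := -X) (b := X)).exists_bound_of_continuousOn
      hf.continuousOn
    obtain ⟨C, hC⟩ := (isCompact_Icc (a := -X) (b := X)).exists_bound_of_continuousOn
      (hYc 0).continuousOn
    refine ⟨max M 0, max C 0, D, le_max_right _ _, le_max_right _ _,
      fun x hx => ⟨(hM x hx).trans (le_max_left _ _), hD x hx⟩, ?_⟩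
    set M' := max M 0
    set C' := max C 0
    have hM0 : 0 ≤ M' := le_max_right _ _
    have hC0 : 0 ≤ C' := le_max_right _ _
    intro n
    induction n with
    | zero =>
      intro x hx
      simp only [pow_zero, Nat.factorial_zero, Nat.cast_one, div_one, mul_one]
      exact (hC x hx).trans (le_max_left _ _)
    | succ n ih =>
      intro x hx
      have hsub : ∀ t ∈ Set.uIoc 0 x, t ∈ Set.Icc (-X) X := by
        intro t ht
        rcases Set.mem_uIoc.1 ht with h | h <;> constructor <;> linarith [hx.1, hx.2, h.1, h.2]
      calc ‖Y (n + 1) x‖ ≤ ∫ t in Set.uIoc 0 x, ‖A t (Y n t)‖ :=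
            intervalIntegral.norm_integral_le_integral_norm_uIoc
        _ ≤ ∫ t in Set.uIoc 0 x, M' * (C' * (M' ^ n / n.factorial)) * |t - 0| ^ n := by
            refine MeasureTheory.setIntegral_mono_on ?_ ?_ measurableSet_uIoc ?_
            · exact intervalIntegrable_iff.1 ((hg n).norm.intervalIntegrable _ _)
            · exact intervalIntegrable_iff.1 (Continuous.intervalIntegrable (by fun_prop) _ _)
            · intro t ht
              have h1 := hsub t ht
              calc ‖A t (Y n t)‖ ≤ ‖A t‖ * ‖Y n t‖ := (A t).le_opNorm _
                _ ≤ M' * (C' * ((M' * |t|) ^ n / n.factorial)) := by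
                    gcongr
                    · exact (hM t h1).trans (le_max_left _ _)
                    · exact ih t h1
                _ = _ := by rw [sub_zero, mul_pow]; ring
        _ = C' * ((M' * |x|) ^ (n + 1) / (n + 1).factorial) := by
            rw [MeasureTheory.integral_const_mul, integral_pow_abs_sub_uIoc]
            have : (n.factorial : ℝ) ≠ 0 := by positivity
            rw [Nat.factorial_succ]
            push_cast
            field_simp
            ring_nf
  have hsum : ∀ x, Summable fun n => Y n x := by
    intro x
    obtain ⟨M, C, D, hM, hC, -, hb⟩ := key |x|
    exact Summable.of_norm_bounded ((Real.summable_pow_div_factorial (M * |x|)).mul_left C)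
      fun n => hb n x ⟨neg_abs_le x, le_abs_self x⟩
  refine ⟨fun x => ∑' n, Y n x, ?_, fun x => ?_⟩
  · dsimp only
    rw [(hsum 0).tsum_eq_zero_add]
    simp [h00, hs0]
  · obtain ⟨M, C, D, hM, hC, hAf, hb⟩ := key (|x| + 1)
    set X := |x| + 1
    have hX : 0 ≤ X := by positivity
    set u : ℕ → ℝ := fun n => Nat.casesOn n D
      (fun m => M * (C * ((M * X) ^ m / m.factorial))) with hu
    have husum : Summable u := (summable_nat_add_iff 1).1
      (((Real.summable_pow_div_factorial (M * X)).mul_left C).mul_left M)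
    have hxX : x ∈ Set.Ioo (-X) X := abs_lt.1 (lt_add_one |x|)
    have := hasDerivAt_tsum_of_isPreconnected (g := Y) (g' := g') husum isOpen_Ioo
      isPreconnected_Ioo (fun n y _ => hd n y) (t := Set.Ioo (-X) X) (y₀ := x) (y := x)
      (fun n y hy => ?_) hxX (hsum x) hxX
    · convert this using 1
      have hs : Summable fun n => g' n x := (summable_nat_add_iff 1).1
        ((hsum x).map (A x) (A x).continuous)
      rw [hs.tsum_eq_zero_add, (A x).map_tsum (hsum x), add_comm]
      rfl
    · have hy' : y ∈ Set.Icc (-X) X := Set.Ioo_subset_Icc_self hy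
      cases n with
      | zero => exact (hAf y hy').2
      | succ m =>
        have hyX : |y| ≤ X := abs_le.2 hy'
        calc ‖A y (Y m y)‖ ≤ ‖A y‖ * ‖Y m y‖ := (A y).le_opNorm _
          _ ≤ M * (C * ((M * |y|) ^ m / m.factorial)) := by
              gcongr
              · exact (hAf y hy').1
              · exact hb m y hy'
          _ ≤ M * (C * ((M * X) ^ m / m.factorial)) := by gcongr

theorem exists_second_order_ode {p f : ℝ → ℂ} (hp : Continuous p) (hf : Continuous f) (a b : ℂ) :
    ∃ y z : ℝ → ℂ, y 0 = a ∧ z 0 = b ∧ (∀ x, HasDerivAt y (z x) x) ∧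
      ∀ x, HasDerivAt z (p x * y x + f x) x := by
  set L₁ : (ℂ × ℂ) →L[ℝ] (ℂ × ℂ) :=
    (ContinuousLinearMap.snd ℝ ℂ ℂ).prod 0
  set L₂ : (ℂ × ℂ) →L[ℝ] (ℂ × ℂ) :=
    (0 : (ℂ × ℂ) →L[ℝ] ℂ).prod (ContinuousLinearMap.fst ℝ ℂ ℂ)
  have hA : Continuous fun x => L₁ + p x • L₂ := continuous_const.add (hp.smul continuous_const)
  obtain ⟨Y, hY0, hY⟩ := exists_linear_ode hA
    (f := fun x => ((0 : ℂ), f x)) (by fun_prop) (a, b)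
  refine ⟨fun x => (Y x).1, fun x => (Y x).2, by simp [hY0], by simp [hY0], fun x => ?_,
    fun x => ?_⟩
  · exact ((ContinuousLinearMap.fst ℝ ℂ ℂ).hasFDerivAt.comp_hasDerivAt x (hY x)).congr_deriv
      (by simp [L₁, L₂])
  · exact ((ContinuousLinearMap.snd ℝ ℂ ℂ).hasFDerivAt.comp_hasDerivAt x (hY x)).congr_deriv
      (by simp [L₁, L₂])

/-- Grönwall for the pair `(y, z)` in the sup norm; `1 ≤ M` lets the same constant absorb the
equation `y' = z`. With `ε = 0` this is uniqueness. -/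
theorem norm_le_of_second_order_ode {p f y z : ℝ → ℂ} {M ε X : ℝ} (hM : 1 ≤ M) (hε : 0 ≤ ε)
    (hp : ∀ x ∈ Set.Icc 0 X, ‖p x‖ ≤ M) (hf : ∀ x ∈ Set.Icc 0 X, ‖f x‖ ≤ ε)
    (hy : ∀ x, HasDerivAt y (z x) x) (hz : ∀ x, HasDerivAt z (p x * y x + f x) x)
    (hy0 : y 0 = 0) (hz0 : z 0 = 0) {x : ℝ} (hx : x ∈ Set.Icc 0 X) :
    ‖y x‖ ≤ ε * Real.exp (M * X) := by
  have hd : ∀ x, HasDerivAt (fun x => (y x, z x)) (z x, p x * y x + f x) x :=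
    fun x => (hy x).prodMk (hz x)
  have := norm_le_gronwallBound_of_norm_deriv_right_le (f := fun x => (y x, z x))
    (f' := fun x => (z x, p x * y x + f x)) (δ := 0) (K := M) (ε := ε) (a := 0) (b := X)
    (fun x _ => (hd x).continuousAt.continuousWithinAt) (fun x _ => (hd x).hasDerivWithinAt)
    (by simp [hy0, hz0]) (fun t ht => ?_) x hx
  · refine (norm_fst_le (y x, z x)).trans (this.trans ?_)
    rw [gronwallBound_of_K_ne_0 (by positivity), sub_zero]
    simp only [zero_mul, zero_add]
    have h1 : ε / M ≤ ε := div_le_self hε hM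
    have h2 : Real.exp (M * x) - 1 ≤ Real.exp (M * X) := by
      have : Real.exp (M * x) ≤ Real.exp (M * X) := by gcongr; exact hx.2
      linarith
    have h3 : 0 ≤ Real.exp (M * x) - 1 := by
      have := Real.one_le_exp (x := M * x) (mul_nonneg (by positivity) hx.1)
      linarith
    exact mul_le_mul h1 h2 h3 hε
  · have ht' : t ∈ Set.Icc 0 X := Set.Ico_subset_Icc_self ht
    have h1 := norm_fst_le (y t, z t)
    have h2 := norm_snd_le (y t, z t)
    have h3 : 0 ≤ ‖(y t, z t)‖ := norm_nonneg _
    refine max_le ?_ ?_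
    · dsimp only at h2 ⊢
      nlinarith
    · calc ‖p t * y t + f t‖ ≤ ‖p t‖ * ‖y t‖ + ‖f t‖ := by
            simpa using norm_add_le (p t * y t) (f t)
        _ ≤ M * ‖(y t, z t)‖ + ε := by
            exact add_le_add (mul_le_mul (hp t ht') h1 (norm_nonneg _) (by positivity)) (hf t ht')

/-- Variation of constants: the integrand is the `t`-derivative of `sin(k(x-t))/k · z + cos(k(x-t))
· y`, which equals `y x` at `t = x` and vanishes at `t = 0`. -/
theorem duhamel {y z h : ℝ → ℂ} {k : ℂ} (hk : k ≠ 0) (hh : Continuous h)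
    (hy : ∀ x, HasDerivAt y (z x) x) (hz : ∀ x, HasDerivAt z (-k ^ 2 * y x + h x) x)
    (hy0 : y 0 = 0) (hz0 : z 0 = 0) (x : ℝ) :
    y x = ∫ t in (0 : ℝ)..x, Complex.sin (k * (x - t)) / k * h t := by
  have hl : ∀ t : ℂ, HasDerivAt (fun t : ℂ => k * ((x : ℂ) - t)) (-k) t := fun t => by
    simpa using ((hasDerivAt_id t).const_sub (x : ℂ)).const_mul k
  have hG : ∀ t ∈ Set.uIcc 0 x, HasDerivAt (fun t : ℝ => Complex.sin (k * (x - t)) / k * z t +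
      Complex.cos (k * (x - t)) * y t) (Complex.sin (k * (x - t)) / k * h t) t := by
    intro t _
    have h1 := (((hl t).csin).div_const k).comp_ofReal.mul (hz t)
    have h2 := ((hl t).ccos).comp_ofReal.mul (hy t)
    refine (h1.add h2).congr_deriv ?_
    field_simp
    ring
  rw [intervalIntegral.integral_eq_sub_of_hasDerivAt hG
    (Continuous.intervalIntegrable (by fun_prop) _ _)]
  simp [hy0, hz0]

/-! ### The solution of Hill's equation and its dependence on the spectral parameter -/

theorem hasDerivAt_of_isSineSolution {q : ℝ → ℂ} {lam : ℂ} {y : ℝ → ℂ}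
    (h : IsSineSolution q lam y) :
    (∀ x, HasDerivAt y (deriv y x) x) ∧
      ∀ x, HasDerivAt (deriv y) ((q x - lam) * y x) x := by
  obtain ⟨h1, h2, -, -⟩ := h
  have h3 : ContDiff ℝ 1 (deriv y) := (contDiff_succ_iff_deriv.1 (one_add_one_eq_two (R := WithTop ℕ∞) ▸ h1)).2.2
  refine ⟨fun x => (h1.differentiable (by norm_num) x).hasDerivAt, fun x => ?_⟩
  refine ((h3.differentiable (by norm_num) x).hasDerivAt).congr_deriv ?_
  linear_combination -h2 x

theorem exists_isSineSolution {q : ℝ → ℂ} (hq : Continuous q) (lam : ℂ) :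
    ∃ y, IsSineSolution q lam y := by
  obtain ⟨y, z, hy0, hz0, hy, hz⟩ := exists_second_order_ode (p := fun x => q x - lam)
    (f := 0) (by fun_prop) continuous_const 0 1
  have e1 : deriv y = z := funext fun x => (hy x).deriv
  have e2 : deriv z = fun x => (q x - lam) * y x := funext fun x => by simpa using (hz x).deriv
  have hyc : Continuous y := continuous_iff_continuousAt.2 fun x => (hy x).continuousAt
  have h2 : ContDiff ℝ (1 + 1) y := by
    rw [contDiff_succ_iff_deriv, e1]
    refine ⟨fun x => (hy x).differentiableAt, by simp, ?_⟩
    rw [contDiff_one_iff_deriv, e2]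
    exact ⟨fun x => (hz x).differentiableAt, by fun_prop⟩
  refine ⟨y, by simpa [one_add_one_eq_two] using h2, fun x => ?_, hy0, by rw [e1, hz0]⟩
  rw [e1, e2]
  ring

theorem isSineSolution_hillV {q : ℝ → ℂ} (hq : Continuous q) (lam : ℂ) :
    IsSineSolution q lam (hillV q lam) :=
  Classical.epsilon_spec (exists_isSineSolution hq lam)

/-- The derivative in `lam` is the solution `V` of the formally differentiated equation. The
remainder `u - v - (lam - lam₀) V` solves the equation for `lam` with zero data and forcing `-(lam -
lam₀)² V`, so Grönwall makes it quadratically small. -/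
theorem differentiable_hillV {q : ℝ → ℂ} (hq : Continuous q) {X : ℝ} (hX : 0 ≤ X) :
    Differentiable ℂ fun lam => hillV q lam X := by
  intro lam₀
  obtain ⟨hv, hv'⟩ := hasDerivAt_of_isSineSolution (isSineSolution_hillV hq lam₀)
  have hv0 := (isSineSolution_hillV hq lam₀).2.2
  set v := hillV q lam₀
  have hvc : Continuous v := continuous_iff_continuousAt.2 fun x => (hv x).continuousAt
  obtain ⟨V, W, hV0, hW0, hV, hW⟩ := exists_second_order_ode (p := fun x => q x - lam₀)
    (f := fun x => -v x) (by fun_prop) (by fun_prop) 0 0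
  have hVc : Continuous V := continuous_iff_continuousAt.2 fun x => (hV x).continuousAt
  obtain ⟨B, hB⟩ := (isCompact_Icc (a := 0) (b := X)).exists_bound_of_continuousOn
    hVc.continuousOn
  obtain ⟨M, hM⟩ := (isCompact_Icc (a := 0) (b := X)).exists_bound_of_continuousOn
    hq.continuousOn
  have hB0 : 0 ≤ B := (norm_nonneg _).trans (hB 0 ⟨le_rfl, hX⟩)
  have hM0 : 0 ≤ M := (norm_nonneg _).trans (hM 0 ⟨le_rfl, hX⟩)
  set K := M + (‖lam₀‖ + 1) with hK
  have hK1 : 1 ≤ K := by linarith [norm_nonneg lam₀]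
  have est : ∀ lam, ‖lam - lam₀‖ ≤ 1 →
      ‖hillV q lam X - v X - (lam - lam₀) * V X‖ ≤
        B * Real.exp (K * X) * ‖(lam - lam₀) ^ 2‖ := by
    intro lam hl
    obtain ⟨hu, hu'⟩ := hasDerivAt_of_isSineSolution (isSineSolution_hillV hq lam)
    have hu0 := (isSineSolution_hillV hq lam).2.2
    set u := hillV q lam
    have := norm_le_of_second_order_ode (p := fun x => q x - lam)
      (f := fun x => -(lam - lam₀) ^ 2 * V x) (M := K) (ε := ‖(lam - lam₀) ^ 2‖ * B) (X := X)
      (y := fun x => u x - v x - (lam - lam₀) * V x)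
      (z := fun x => deriv u x - deriv v x - (lam - lam₀) * W x) hK1 (by positivity)
      (fun x hx => ?_) (fun x hx => ?_)
      (fun x => ((hu x).sub (hv x)).sub ((hV x).const_mul _))
      (fun x => (((hu' x).sub (hv' x)).sub ((hW x).const_mul _)).congr_deriv ?_)
      (by simp [hu0.1, hv0.1, hV0]) (by simp [hu0.2, hv0.2, hW0]) (x := X) ⟨hX, le_rfl⟩
    · exact this.trans (le_of_eq (by ring))
    · have h1 : ‖lam‖ ≤ ‖lam₀‖ + 1 := by
        calc ‖lam‖ = ‖lam₀ + (lam - lam₀)‖ := by simp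
          _ ≤ _ := (norm_add_le _ _).trans (by gcongr)
      exact (norm_sub_le _ _).trans (add_le_add (hM x hx) h1)
    · rw [norm_mul, norm_neg]
      gcongr
      exact hB x hx
    · ring
  have hO : (fun lam => hillV q lam X - v X - (lam - lam₀) * V X) =O[𝓝 lam₀]
      fun lam => (lam - lam₀) ^ 2 :=
    Asymptotics.IsBigO.of_bound (B * Real.exp (K * X)) (by
      filter_upwards [Metric.closedBall_mem_nhds lam₀ one_pos] with lam hl
      exact est lam (by simpa [dist_eq_norm] using hl))
  have : HasDerivAt (fun lam => hillV q lam X) (V X) lam₀ := by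
    rw [hasDerivAt_iff_isLittleO]
    have ho : (fun lam : ℂ => (lam - lam₀) ^ 2) =o[𝓝 lam₀] fun lam => lam - lam₀ := by
      have h1 : Tendsto (fun lam : ℂ => lam - lam₀) (𝓝 lam₀) (𝓝 0) := by
        have : Continuous fun lam : ℂ => lam - lam₀ := by fun_prop
        simpa using this.tendsto lam₀
      exact (Asymptotics.isLittleO_pow_id one_lt_two).comp_tendsto h1
    simpa [smul_eq_mul] using hO.trans_isLittleO ho
  exact this.differentiableAt

/-! ### The free solution and bounds for the complex sine -/

theorem hillV_zero_sq {k : ℂ} (hk : k ≠ 0) (x : ℝ) :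
    hillV (fun _ => 0) (k ^ 2) x = Complex.sin (k * x) / k := by
  have h := isSineSolution_hillV (q := fun _ => 0) continuous_const (k ^ 2)
  obtain ⟨hu, hu'⟩ := hasDerivAt_of_isSineSolution h
  have hl : ∀ t : ℂ, HasDerivAt (fun t : ℂ => k * t) k t := fun t => by
    simpa using (hasDerivAt_id t).const_mul k
  have := duhamel hk (h := 0) continuous_const
    (y := fun x => hillV (fun _ => 0) (k ^ 2) x - Complex.sin (k * x) / k)
    (z := fun x => deriv (hillV (fun _ => 0) (k ^ 2)) x - Complex.cos (k * x))
    (fun x => ((hu x).sub ((hl x).csin.div_const k).comp_ofReal).congr_deriv (by field_simp))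
    (fun x => ((hu' x).sub (hl x).ccos.comp_ofReal).congr_deriv (by simp only [Pi.zero_apply]; field_simp; ring))
    (by simp [h.2.2.1]) (by simp [h.2.2.2]) x
  simpa [sub_eq_zero] using this

theorem norm_sin_le_exp (z : ℂ) : ‖Complex.sin z‖ ≤ Real.exp |z.im| := by
  have h1 : ‖Complex.exp (-z * Complex.I)‖ ≤ Real.exp |z.im| := by
    rw [Complex.norm_exp]
    simpa using le_abs_self z.im
  have h2 : ‖Complex.exp (z * Complex.I)‖ ≤ Real.exp |z.im| := by
    rw [Complex.norm_exp]
    simpa using neg_le_abs z.im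
  rw [Complex.sin, norm_div, norm_mul, Complex.norm_I, mul_one, Complex.norm_ofNat]
  linarith [norm_sub_le (Complex.exp (-z * Complex.I)) (Complex.exp (z * Complex.I))]

theorem norm_sin_mul_ofReal_le (k : ℂ) {t : ℝ} (ht : 0 ≤ t) :
    ‖Complex.sin (k * t)‖ ≤ Real.exp (|k.im| * t) := by
  simpa [abs_mul, abs_of_nonneg ht] using norm_sin_le_exp (k * t)

theorem exp_sub_exp_neg_le_norm_sin (z : ℂ) :
    (Real.exp |z.im| - Real.exp (-|z.im|)) / 2 ≤ ‖Complex.sin z‖ := by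
  have h1 : ‖Complex.exp (-z * Complex.I)‖ = Real.exp z.im := by
    rw [Complex.norm_exp]
    simp
  have h2 : ‖Complex.exp (z * Complex.I)‖ = Real.exp (-z.im) := by
    rw [Complex.norm_exp]
    simp
  rw [Complex.sin, norm_div, norm_mul, Complex.norm_I, mul_one, Complex.norm_ofNat]
  have := abs_norm_sub_norm_le (Complex.exp (-z * Complex.I)) (Complex.exp (z * Complex.I))
  rw [h1, h2] at this
  rcases abs_cases z.im with ⟨h, _⟩ | ⟨h, _⟩ <;> rw [h]
  · linarith [(abs_le.1 this).2]
  · rw [neg_neg]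
    linarith [(abs_le.1 this).1]

/-- For `|Im z| ≥ 1` the `sinh` lower bound suffices. For `|Im z| ≤ 1` the point lies near the real
axis, so `|Re z|` is within `1/4` of `π(N + 1/2)`, where the real sine has modulus at least `1/2`.
-/
theorem exp_abs_im_le_norm_sin {N : ℕ} (hN : 1 ≤ N) {z : ℂ} (hz : ‖z‖ = Real.pi * (N + 1 / 2)) :
    Real.exp |z.im| ≤ 4 * ‖Complex.sin z‖ := by
  rcases le_total 1 |z.im| with hy | hy
  · have h1 := exp_sub_exp_neg_le_norm_sin z
    have h2 : 2 ≤ Real.exp |z.im| := by linarith [Real.add_one_le_exp |z.im|]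
    have h3 : Real.exp (-|z.im|) ≤ Real.exp |z.im| / 2 := by
      rw [Real.exp_neg, inv_le_comm₀ (by positivity) (by positivity), inv_div]
      exact (div_le_one (by positivity)).2 h2 |>.trans (by linarith)
    linarith
  · set ρ := Real.pi * (N + 1 / 2)
    have hρ : 4 ≤ ρ := by
      have : (1 : ℝ) ≤ N := by exact_mod_cast hN
      calc (4 : ℝ) ≤ 3 * (1 + 1 / 2) := by norm_num
        _ ≤ ρ := 
            mul_le_mul Real.pi_gt_three.le (by linarith) (by norm_num) Real.pi_pos.le
    have hsq : z.re ^ 2 + z.im ^ 2 = ρ ^ 2 := by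
      rw [← hz, Complex.sq_norm, Complex.normSq_apply]
      ring
    have hx : |z.re| ≤ ρ := hz ▸ Complex.abs_re_le_norm z
    have hx0 := abs_nonneg z.re
    -- From `(ρ - |z.re|)(ρ + |z.re|) = z.im² ≤ 1` and `ρ ≥ 4`.
    have hδ : ρ - |z.re| ≤ 1 / 4 := by
      have h1 : |z.re| ^ 2 = z.re ^ 2 := sq_abs _
      have h2 : z.im ^ 2 ≤ 1 := (sq_le_one_iff_abs_le_one _).2 hy
      nlinarith
    have hs : 1 / 2 ≤ |Real.sin z.re| := by
      have h1 : |Real.sin z.re| = |Real.sin (|z.re|)| := by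
        rcases abs_cases z.re with ⟨h, _⟩ | ⟨h, _⟩ <;> rw [h]
        rw [Real.sin_neg, abs_neg]
      have h2 : |z.re| = N * Real.pi + (Real.pi / 2 - (ρ - |z.re|)) := by
        simp only [ρ]
        ring
      rw [h1, h2, Real.sin_add, Real.sin_nat_mul_pi, Real.cos_nat_mul_pi, Real.sin_pi_div_two_sub,
        zero_mul, zero_add, abs_mul, abs_neg_one_pow, one_mul]
      refine le_trans ?_ (le_abs_self _)
      have := Real.one_sub_sq_div_two_le_cos (x := ρ - |z.re|)
      nlinarith
    have h1 : |Real.sin z.re| * Real.cosh z.im ≤ ‖Complex.sin z‖ := by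
      have h2 : (Complex.sin z).re = Real.sin z.re * Real.cosh z.im := by
        rw [Complex.sin_eq]
        simp [Complex.sin_ofReal_re, Complex.cosh_ofReal_re, Complex.sin_ofReal_im,
          Complex.cosh_ofReal_im, Complex.cos_ofReal_im, Complex.sinh_ofReal_im]
      rw [← abs_of_pos (Real.cosh_pos z.im), ← abs_mul, ← h2]
      exact Complex.abs_re_le_norm _
    have h2 : Real.exp |z.im| / 2 ≤ Real.cosh z.im := by
      rw [← Real.cosh_abs, Real.cosh_eq]
      have := Real.exp_pos (-|z.im|)
      linarith
    nlinarith [Real.exp_pos |z.im|]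

/-! ### Asymptotics of the solution for large `k` -/

/-- Let `S` be the maximum of `‖e x‖ exp(-|Im k| x)` on `[0, X]`. The integral equation yields `S ≤
X (M S + D) / ‖k‖`, and `hkM` allows the `S` term to be absorbed on the left. -/
theorem norm_le_of_duhamel {q e r : ℝ → ℂ} {k : ℂ} {M D X : ℝ} (hk : k ≠ 0) (hX : 0 ≤ X)
    (hD : 0 ≤ D) (hM : 0 ≤ M) (hkM : 2 * (X * M) ≤ ‖k‖)
    (he : Continuous e) (hqM : ∀ x ∈ Set.Icc 0 X, ‖q x‖ ≤ M)
    (hr : ∀ x ∈ Set.Icc 0 X, ‖r x‖ ≤ D * Real.exp (|k.im| * x))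
    (hint : ∀ x, e x = ∫ t in (0 : ℝ)..x, Complex.sin (k * (x - t)) / k * (q t * e t + r t)) :
    ‖e X‖ ≤ 2 * X * D / ‖k‖ * Real.exp (|k.im| * X) := by
  set τ := |k.im|
  have hk0 : 0 < ‖k‖ := norm_pos_iff.2 hk
  obtain ⟨x₀, hx₀, hmax⟩ := (isCompact_Icc (a := 0) (b := X)).exists_isMaxOn
    ⟨0, le_rfl, hX⟩ (f := fun x => ‖e x‖ * Real.exp (-(τ * x))) (by fun_prop)
  set S := ‖e x₀‖ * Real.exp (-(τ * x₀)) with hS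
  have hle : ∀ x ∈ Set.Icc 0 X, ‖e x‖ ≤ S * Real.exp (τ * x) := by
    intro x hx
    have h1 : ‖e x‖ * Real.exp (-(τ * x)) ≤ S := hmax hx
    rwa [Real.exp_neg, ← div_eq_mul_inv, div_le_iff₀ (Real.exp_pos _)] at h1
  have hS0 : 0 ≤ S := by positivity
  have h2 : ‖e x₀‖ ≤ (Real.exp (τ * x₀) / ‖k‖ * (M * S + D)) * |x₀ - 0| := by
    rw [hint x₀]
    refine intervalIntegral.norm_integral_le_of_norm_le_const fun t ht => ?_
    rw [Set.uIoc_of_le hx₀.1] at ht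
    have ht' : t ∈ Set.Icc 0 X := ⟨ht.1.le, ht.2.trans hx₀.2⟩
    have hs := norm_sin_mul_ofReal_le k (sub_nonneg.2 ht.2)
    push_cast at hs
    have hb : ‖q t * e t + r t‖ ≤ (M * S + D) * Real.exp (τ * t) := by
      calc ‖q t * e t + r t‖ ≤ ‖q t‖ * ‖e t‖ + ‖r t‖ := by
            simpa using norm_add_le (q t * e t) (r t)
        _ ≤ M * (S * Real.exp (τ * t)) + D * Real.exp (τ * t) :=
            add_le_add (mul_le_mul (hqM t ht') (hle t ht') (norm_nonneg _) hM) (hr t ht')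
        _ = _ := by ring
    rw [norm_mul, norm_div]
    calc ‖Complex.sin (k * (x₀ - t))‖ / ‖k‖ * ‖q t * e t + r t‖
        ≤ Real.exp (τ * (x₀ - t)) / ‖k‖ * ((M * S + D) * Real.exp (τ * t)) := by gcongr
      _ = (Real.exp (τ * (x₀ - t)) * Real.exp (τ * t)) / ‖k‖ * (M * S + D) := by ring
      _ = _ := by rw [← Real.exp_add]; ring_nf
  have h3 : S ≤ X * (M * S + D) / ‖k‖ := by
    have h4 : S ≤ x₀ * (M * S + D) / ‖k‖ := by
      rw [sub_zero, abs_of_nonneg hx₀.1] at h2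
      calc S ≤ (Real.exp (τ * x₀) / ‖k‖ * (M * S + D)) * x₀ * Real.exp (-(τ * x₀)) := by
            rw [hS]; gcongr
        _ = (Real.exp (τ * x₀) * Real.exp (-(τ * x₀))) * (x₀ * (M * S + D) / ‖k‖) := by ring
        _ = _ := by rw [← Real.exp_add, add_neg_cancel, Real.exp_zero, one_mul]
    refine h4.trans ?_
    gcongr
    exact hx₀.2
  have h5 : S ≤ 2 * X * D / ‖k‖ := by
    rw [le_div_iff₀ hk0] at h3 ⊢
    nlinarith
  exact (hle X ⟨hX, le_rfl⟩).trans (by gcongr)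

theorem hillV_asymptotic {q : ℝ → ℂ} (hq : ContDiff ℝ 2 q) {X : ℝ} (hX : 0 ≤ X)
    (hQ : ∫ x in (0 : ℝ)..X, q x = 0) (hqX : q X = q 0) :
    ∃ C K : ℝ, 0 ≤ C ∧ 0 < K ∧ ∀ k : ℂ, K ≤ ‖k‖ →
      ‖hillV q (k ^ 2) X - (1 + q 0 / (2 * k ^ 2)) * (Complex.sin (k * X) / k)‖ ≤
        C * Real.exp (|k.im| * X) / ‖k‖ ^ 4 := by
  have hqc : Continuous q := hq.continuous
  have hq1 : ContDiff ℝ 1 (deriv q) :=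
    (contDiff_succ_iff_deriv.1 (one_add_one_eq_two (R := WithTop ℕ∞) ▸ hq)).2.2
  have hq1c : Continuous (deriv q) := hq1.continuous
  have hq2c : Continuous (deriv (deriv q)) := hq1.continuous_deriv le_rfl
  have hdq : ∀ x, HasDerivAt q (deriv q x) x :=
    fun x => (hq.differentiable (by norm_num) x).hasDerivAt
  have hdq1 : ∀ x, HasDerivAt (deriv q) (deriv (deriv q) x) x :=
    fun x => (hq1.differentiable (by norm_num) x).hasDerivAt
  set Q : ℝ → ℂ := fun x => ∫ t in (0 : ℝ)..x, q t with hQdef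
  have hdQ : ∀ x, HasDerivAt Q (q x) x := fun x => (hqc.integral_hasStrictDerivAt 0 x).hasDerivAt
  have hQc : Continuous Q := continuous_iff_continuousAt.2 fun x => (hdQ x).continuousAt
  have hQ0 : Q 0 = 0 := by simp [hQdef]
  -- Matching powers of `k` for the ansatz `w` below forces the coefficient `-Q/2` of the cosine
  -- term and `a' = (q' - Q q)/4`; the constant of integration `q 0 / 4` is the one that makes `w₁ 0
  -- = 1`. The uncancelled remainder is `s (q a - a'')/k²`, which is where two derivatives of `q`
  -- are used.
  set a : ℝ → ℂ := fun x => q x / 4 + q 0 / 4 - Q x ^ 2 / 8 with ha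
  set a₁ : ℝ → ℂ := fun x => deriv q x / 4 - Q x * q x / 4 with ha₁
  set a₂ : ℝ → ℂ := fun x => deriv (deriv q) x / 4 - (q x ^ 2 + Q x * deriv q x) / 4 with ha₂
  have hda : ∀ x, HasDerivAt a (a₁ x) x := fun x =>
    ((((hdq x).div_const 4).add_const (q 0 / 4)).sub (((hdQ x).pow 2).div_const 8)).congr_deriv
      (by simp only [ha₁]; push_cast; ring)
  have hda₁ : ∀ x, HasDerivAt a₁ (a₂ x) x := fun x =>
    (((hdq1 x).div_const 4).sub (((hdQ x).mul (hdq x)).div_const 4)).congr_deriv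
      (by simp only [ha₂]; ring)
  have hrc : Continuous fun x => q x * a x - a₂ x := by fun_prop
  obtain ⟨M, hM⟩ := (isCompact_Icc (a := 0) (b := X)).exists_bound_of_continuousOn
    hqc.continuousOn
  obtain ⟨D, hD⟩ := (isCompact_Icc (a := 0) (b := X)).exists_bound_of_continuousOn
    hrc.continuousOn
  have hM0 : 0 ≤ M := (norm_nonneg _).trans (hM 0 ⟨le_rfl, hX⟩)
  have hD0 : 0 ≤ D := (norm_nonneg _).trans (hD 0 ⟨le_rfl, hX⟩)
  refine ⟨2 * X * D, 2 * (X * M) + 1, by positivity, by positivity, fun k hk => ?_⟩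
  have hkpos : 0 < ‖k‖ := lt_of_lt_of_le (by positivity) hk
  have hk0 : k ≠ 0 := norm_pos_iff.1 hkpos
  obtain ⟨hv, hv'⟩ := hasDerivAt_of_isSineSolution (isSineSolution_hillV hqc (k ^ 2))
  have hv0 := (isSineSolution_hillV hqc (k ^ 2)).2.2
  set v := hillV q (k ^ 2)
  have hl : ∀ t : ℂ, HasDerivAt (fun t : ℂ => k * t) k t := fun t => by
    simpa using (hasDerivAt_id t).const_mul k
  set s : ℝ → ℂ := fun x => Complex.sin (k * x) / k with hs
  set c : ℝ → ℂ := fun x => Complex.cos (k * x) with hc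
  have hds : ∀ x, HasDerivAt s (c x) x := fun x =>
    ((hl x).csin.div_const k).comp_ofReal.congr_deriv (by simp only [hc]; field_simp)
  have hdc : ∀ x, HasDerivAt c (-k ^ 2 * s x) x := fun x =>
    (hl x).ccos.comp_ofReal.congr_deriv (by simp only [hs]; field_simp)
  set w : ℝ → ℂ := fun x => (1 + a x / k ^ 2) * s x - Q x / 2 * c x / k ^ 2 with hw
  set w₁ : ℝ → ℂ := fun x => a₁ x / k ^ 2 * s x + (1 + a x / k ^ 2) * c x - q x / 2 * c x / k ^ 2 +
    Q x / 2 * s x with hw₁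
  have hdw : ∀ x, HasDerivAt w (w₁ x) x := fun x =>
    (((((hda x).div_const (k ^ 2)).const_add 1).mul (hds x)).sub
      ((((hdQ x).div_const 2).mul (hdc x)).div_const (k ^ 2))).congr_deriv
      (by simp only [hw₁]; field_simp; ring)
  have hdw₁ : ∀ x, HasDerivAt w₁
      ((q x - k ^ 2) * w x - s x * (q x * a x - a₂ x) / k ^ 2) x := fun x =>
    ((((((hda₁ x).div_const (k ^ 2)).mul (hds x)).add
      ((((hda x).div_const (k ^ 2)).const_add 1).mul (hdc x))).sub
      ((((hdq x).div_const 2).mul (hdc x)).div_const (k ^ 2))).add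
      (((hdQ x).div_const 2).mul (hds x))).congr_deriv
      (by simp only [hw, ha₁]; field_simp; ring)
  have hs0 : s 0 = 0 := by simp [hs]
  have hc0 : c 0 = 1 := by simp [hc]
  have hw0 : w 0 = 0 := by simp [hw, hs0, hQ0]
  have hw₁0 : w₁ 0 = 1 := by simp only [hw₁, hs0, hc0, hQ0, ha]; ring
  have hvc : Continuous v := continuous_iff_continuousAt.2 fun x => (hv x).continuousAt
  have hwc : Continuous w := continuous_iff_continuousAt.2 fun x => (hdw x).continuousAt
  have hsc : Continuous s := continuous_iff_continuousAt.2 fun x => (hds x).continuousAt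
  have hduh := duhamel hk0 (y := fun x => v x - w x) (z := fun x => deriv v x - w₁ x)
    (h := fun x => q x * (v x - w x) + s x * (q x * a x - a₂ x) / k ^ 2) (by fun_prop)
    (fun x => (hv x).sub (hdw x)) (fun x => ((hv' x).sub (hdw₁ x)).congr_deriv (by ring))
    (by simp [hv0.1, hw0]) (by simp [hv0.2, hw₁0])
  have hwX : w X = (1 + q 0 / (2 * k ^ 2)) * (Complex.sin (k * X) / k) := by
    simp only [hw, ha, show Q X = 0 from hQ, hqX, hs]
    field_simp
    ring
  -- The remainder carries `1/k²`, the factor `s` another `1/‖k‖`, whence `D / ‖k‖ ^ 3`; the Duhamel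
  -- kernel supplies the fourth power.
  have := norm_le_of_duhamel (q := q) (e := fun x => v x - w x)
    (r := fun x => s x * (q x * a x - a₂ x) / k ^ 2) (D := D / ‖k‖ ^ 3) hk0 hX (by positivity) hM0
    (by linarith) (by fun_prop) hM (fun x hx => ?_) hduh
  · rw [← hwX]
    refine this.trans (le_of_eq ?_)
    field_simp
  · have h1 : ‖s x‖ ≤ Real.exp (|k.im| * x) / ‖k‖ := by
      rw [hs, norm_div]
      gcongr
      exact norm_sin_mul_ofReal_le k hx.1
    rw [norm_div, norm_mul, norm_pow]
    calc ‖s x‖ * ‖q x * a x - a₂ x‖ / ‖k‖ ^ 2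
        ≤ Real.exp (|k.im| * x) / ‖k‖ * D / ‖k‖ ^ 2 := by
          gcongr
          exact hD x hx
      _ = _ := by field_simp

/-! ### Zeros of the free problem -/

theorem hillV_zero_zero {x : ℝ} (hx : 0 ≤ x) : hillV (fun _ => 0) 0 x = x := by
  have h := isSineSolution_hillV (q := fun _ => 0) continuous_const 0
  obtain ⟨hu, hu'⟩ := hasDerivAt_of_isSineSolution h
  have := norm_le_of_second_order_ode (M := 1) (ε := 0) (X := x) (p := 0) (f := 0)
    (y := fun x => hillV (fun _ => 0) 0 x - x) (z := fun x => deriv (hillV (fun _ => 0) 0) x - 1)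
    le_rfl le_rfl (by simp) (by simp)
    (fun t => (hu t).sub (hasDerivAt_id (t : ℂ)).comp_ofReal)
    (fun t => ((hu' t).sub_const 1).congr_deriv (by simp))
    (by simp [h.2.2.1]) (by simp [h.2.2.2]) (x := x) ⟨hx, le_rfl⟩
  rw [zero_mul] at this
  exact sub_eq_zero.1 (norm_le_zero_iff.1 this)

theorem hillV_zero_two_pi_eq_zero_iff (lam : ℂ) :
    hillV (fun _ => 0) lam (2 * Real.pi) = 0 ↔ ∃ n : ℕ, 1 ≤ n ∧ lam = (n : ℂ) ^ 2 / 4 := by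
  have hpi : (Real.pi : ℂ) ≠ 0 := by exact_mod_cast Real.pi_ne_zero
  obtain ⟨k, rfl⟩ := IsAlgClosed.exists_pow_nat_eq lam two_pos
  rcases eq_or_ne k 0 with rfl | hk
  · rw [zero_pow two_ne_zero, hillV_zero_zero (by positivity)]
    refine ⟨fun h => absurd h (by simp [Real.pi_ne_zero]), ?_⟩
    rintro ⟨n, hn, h⟩
    have : (n : ℂ) = 0 := by simpa using h.symm
    exact absurd (Nat.cast_eq_zero.1 this) (by omega)
  · rw [hillV_zero_sq hk, div_eq_zero_iff, or_iff_left hk, Complex.sin_eq_zero_iff]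
    constructor
    · rintro ⟨m, hm⟩
      have h1 : k = m / 2 := by
        push_cast at hm
        apply mul_right_cancel₀ hpi
        linear_combination hm / 2
      refine ⟨m.natAbs, ?_, ?_⟩
      · rw [Nat.one_le_iff_ne_zero, Int.natAbs_ne_zero]
        rintro rfl
        exact hk (by simpa using h1)
      · have h2 : ((m.natAbs : ℂ)) ^ 2 = (m : ℂ) ^ 2 := by
          rw [← Int.cast_natCast, ← Int.cast_pow, Int.natAbs_sq, Int.cast_pow]
        rw [h1, h2]
        ring
    · rintro ⟨n, -, h⟩
      have h1 : (k - n / 2) * (k + n / 2) = 0 := by linear_combination h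
      rcases mul_eq_zero.1 h1 with h2 | h2
      · exact ⟨n, by push_cast; linear_combination 2 * (Real.pi : ℂ) * h2⟩
      · exact ⟨-n, by push_cast; linear_combination 2 * (Real.pi : ℂ) * h2⟩

theorem analyticOrderAt_hillV_zero {n : ℕ} (hn : 1 ≤ n) :
    analyticOrderAt (fun lam => hillV (fun _ => 0) lam (2 * Real.pi)) ((n : ℂ) ^ 2 / 4) = 1 := by
  set F := fun lam => hillV (fun _ => 0) lam (2 * Real.pi) with hF
  have hpi : (Real.pi : ℂ) ≠ 0 := by exact_mod_cast Real.pi_ne_zero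
  have hFd : Differentiable ℂ F := differentiable_hillV continuous_const (by positivity)
  have h0 : F ((n : ℂ) ^ 2 / 4) = 0 := (hillV_zero_two_pi_eq_zero_iff _).2 ⟨n, hn, rfl⟩
  refine AnalyticAt.analyticOrderAt_eq_one_of_zero_deriv_ne_zero (hFd.analyticAt _) h0
    fun hder => ?_
  have hn0 : (n : ℂ) ≠ 0 := by exact_mod_cast (by omega : n ≠ 0)
  have hk : (n : ℂ) / 2 ≠ 0 := by simpa using hn0
  have hsq : ((n : ℂ) / 2) ^ 2 = (n : ℂ) ^ 2 / 4 := by ring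
  have h1 : HasDerivAt F 0 (((n : ℂ) / 2) ^ 2) := by
    rw [hsq, ← hder]
    exact (hFd _).hasDerivAt
  -- A double zero of `F` would make the derivative of `k F(k²) = sin(2πk)` vanish at `k = n/2`, but
  -- it is `2π cos(πn) ≠ 0`.
  have h2 : HasDerivAt (fun k : ℂ => k * F (k ^ 2)) 0 ((n : ℂ) / 2) := by
    have := (hasDerivAt_id ((n : ℂ) / 2)).mul (h1.comp ((n : ℂ) / 2)
      (hasDerivAt_pow 2 ((n : ℂ) / 2)))
    refine this.congr_deriv ?_
    simp [hsq, h0]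
  have h3 : HasDerivAt (fun k : ℂ => Complex.sin (k * (2 * Real.pi : ℝ)))
      (Complex.cos ((n : ℂ) / 2 * (2 * Real.pi : ℝ)) * (2 * Real.pi : ℝ)) ((n : ℂ) / 2) := by
    simpa using ((hasDerivAt_id ((n : ℂ) / 2)).mul_const ((2 * Real.pi : ℝ) : ℂ)).csin
  have h4 : (fun k : ℂ => k * F (k ^ 2)) =ᶠ[𝓝 ((n : ℂ) / 2)]
      fun k : ℂ => Complex.sin (k * (2 * Real.pi : ℝ)) := by
    filter_upwards [isOpen_ne.mem_nhds hk] with k hk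
    rw [hF]
    dsimp only
    rw [hillV_zero_sq hk, mul_div_cancel₀ _ hk]
  have h5 := (h3.congr_of_eventuallyEq h4).unique h2
  have h6 : (n : ℂ) / 2 * (2 * Real.pi : ℝ) = (n : ℝ) * (Real.pi : ℝ) := by push_cast; ring
  rw [h6, ← Complex.ofReal_mul, ← Complex.ofReal_cos, Real.cos_nat_mul_pi] at h5
  simp [Real.pi_ne_zero] at h5

/-! ### Argument principle with a weight -/

theorem exists_eq_prod_mul {F : ℂ → ℂ} (hF : Differentiable ℂ F)
    (htop : ∀ z, analyticOrderAt F z ≠ ⊤) (S : Finset ℂ) :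
    ∃ G : ℂ → ℂ, Differentiable ℂ G ∧ (∀ z ∈ S, G z ≠ 0) ∧
      ∀ x, F x = (∏ z ∈ S, (x - z) ^ analyticOrderNatAt F z) * G x := by
  induction S using Finset.induction_on with
  | empty => exact ⟨F, hF, by simp, by simp⟩
  | insert a S ha ih =>
    obtain ⟨G, hG, hGS, hFG⟩ := ih
    set P : ℂ → ℂ := fun x => ∏ z ∈ S, (x - z) ^ analyticOrderNatAt F z with hP
    have hPd : Differentiable ℂ P := by fun_prop
    have hPa : P a ≠ 0 := Finset.prod_ne_zero_iff.2 fun z hz =>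
      pow_ne_zero _ (sub_ne_zero.2 fun h => ha (h ▸ hz))
    have hord : analyticOrderAt F a = analyticOrderAt G a := by
      have h1 : F = P * G := funext hFG
      rw [h1, analyticOrderAt_mul (hPd.analyticAt a) (hG.analyticAt a),
        ((hPd.analyticAt a).analyticOrderAt_eq_zero).2 hPa, zero_add]
    have hn : analyticOrderAt G a = (analyticOrderNatAt F a : ℕ) := by
      rw [← hord, Nat.cast_analyticOrderNatAt (htop a)]
    obtain ⟨g, hg, hga, hGg⟩ := ((hG.analyticAt a).analyticOrderAt_eq_natCast).1 hn
    set n := analyticOrderNatAt F a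
    -- The quotient with its removable singularity filled by the local factor `g`.
    set G' : ℂ → ℂ := fun x => if x = a then g a else G x / (x - a) ^ n with hG'
    have hmul : ∀ x, G x = (x - a) ^ n * G' x := by
      intro x
      by_cases hx : x = a
      · subst hx
        simpa [hG'] using hGg.self_of_nhds
      · simp only [hG', if_neg hx]
        rw [mul_div_cancel₀]
        exact pow_ne_zero _ (sub_ne_zero.2 hx)
    refine ⟨G', fun x => ?_, ?_, fun x => ?_⟩
    · by_cases hx : x = a
      · subst hx
        refine hg.differentiableAt.congr_of_eventuallyEq ?_
        filter_upwards [hGg] with y hy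
        by_cases hyx : y = x
        · simp [hG', hyx]
        · simp only [hG', if_neg hyx]
          rw [hy, smul_eq_mul, mul_div_cancel_left₀]
          exact pow_ne_zero _ (sub_ne_zero.2 hyx)
      · have h1 : DifferentiableAt ℂ (fun x => G x / (x - a) ^ n) x :=
          (hG x).div (by fun_prop) (pow_ne_zero _ (sub_ne_zero.2 hx))
        refine h1.congr_of_eventuallyEq ?_
        filter_upwards [isOpen_ne.mem_nhds hx] with y hy
        exact if_neg hy
    · intro z hz
      rcases Finset.mem_insert.1 hz with rfl | hz
      · simpa [hG'] using hga
      · intro h0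
        exact hGS z hz (by rw [hmul, h0, mul_zero])
    · rw [Finset.prod_insert ha, hFG, hmul]
      ring

/-- After the zeros in the disc are factored out, the logarithmic derivative is a sum of simple
poles plus `G'/G`, holomorphic on the disc. Cauchy's formula handles the first and Cauchy's theorem
the second. -/
theorem circleIntegral_mul_logDeriv {F w : ℂ → ℂ} (hF : Differentiable ℂ F)
    (hw : Differentiable ℂ w) (htop : ∀ z, analyticOrderAt F z ≠ ⊤) {R : ℝ} (hR : 0 < R)
    {S : Finset ℂ} (hS : ∀ z, z ∈ S ↔ F z = 0 ∧ ‖z‖ < R)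
    (hsph : ∀ z ∈ Metric.sphere (0 : ℂ) R, F z ≠ 0) :
    ∮ z in C(0, R), w z * logDeriv F z =
      2 * Real.pi * Complex.I * ∑ z ∈ S, (analyticOrderNatAt F z : ℂ) * w z := by
  obtain ⟨G, hG, hGS, hFG⟩ := exists_eq_prod_mul hF htop S
  have hball : ∀ z ∈ S, z ∈ Metric.ball (0 : ℂ) R := fun z hz => by
    simpa using ((hS z).1 hz).2
  have hG0 : ∀ z ∈ Metric.closedBall (0 : ℂ) R, G z ≠ 0 := by
    intro z hz h0
    have hFz : F z = 0 := by rw [hFG, h0, mul_zero]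
    rcases (mem_closedBall_zero_iff.1 hz).lt_or_eq with h | h
    · exact hGS z ((hS z).2 ⟨hFz, h⟩) h0
    · exact hsph z (by simpa using h) hFz
  have hG' : Differentiable ℂ (deriv G) := fun z =>
    ((hG.analyticAt z).deriv).differentiableAt
  have hne : ∀ z ∈ Metric.sphere (0 : ℂ) R, ∀ a ∈ S, z - a ≠ 0 := by
    intro z hz a ha h0
    have h1 := ((hS a).1 ha).2
    rw [← sub_eq_zero.1 h0] at h1
    exact h1.ne (by simpa using hz)
  have hlog : ∀ z ∈ Metric.sphere (0 : ℂ) R, w z * logDeriv F z =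
      (∑ a ∈ S, (z - a)⁻¹ * ((analyticOrderNatAt F a : ℂ) * w z)) + w z * (deriv G z / G z) := by
    intro z hz
    have h1 : F = fun x => (∏ a ∈ S, (x - a) ^ analyticOrderNatAt F a) * G x := funext hFG
    have h2 : ∀ a ∈ S, (z - a) ^ analyticOrderNatAt F a ≠ 0 := fun a ha =>
      pow_ne_zero _ (hne z hz a ha)
    conv_lhs => rw [h1]
    rw [logDeriv_mul z (Finset.prod_ne_zero_iff.2 h2) (hG0 z (Metric.sphere_subset_closedBall hz))
      (by fun_prop) (hG z), logDeriv_prod h2 (fun a _ => by fun_prop), mul_add, Finset.mul_sum,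
      logDeriv_apply G]
    congr 1
    refine Finset.sum_congr rfl fun a ha => ?_
    rw [logDeriv_fun_pow (by fun_prop), logDeriv_apply]
    simp
    ring
  have hci : ∀ a ∈ S, CircleIntegrable
      (fun z => (z - a)⁻¹ * ((analyticOrderNatAt F a : ℂ) * w z)) 0 R := fun a ha =>
    ContinuousOn.circleIntegrable hR.le
      (((continuousOn_id.sub continuousOn_const).inv₀ fun z hz => hne z hz a ha).mul
        (continuousOn_const.mul hw.continuous.continuousOn))
  have hGc : ContinuousOn (fun z => w z * (deriv G z / G z)) (Metric.closedBall 0 R) :=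
    hw.continuous.continuousOn.mul
      (hG'.continuous.continuousOn.div hG.continuous.continuousOn hG0)
  rw [circleIntegral.integral_congr hR.le hlog, circleIntegral.integral_add
    (CircleIntegrable.fun_sum S hci)
    ((hGc.mono Metric.sphere_subset_closedBall).circleIntegrable hR.le),
    circleIntegral.integral_fun_sum hci, Finset.mul_sum]
  rw [Complex.circleIntegral_eq_zero_of_differentiable_on_off_countable hR.le Set.countable_empty
    hGc (fun z hz => (hw z).mul ((hG' z).div (hG z)
      (hG0 z (Metric.ball_subset_closedBall hz.1)))), add_zero]
  refine Finset.sum_congr rfl fun a ha => ?_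
  have := Complex.circleIntegral_sub_inv_smul_of_differentiable_on_off_countable
    (f := fun z => (analyticOrderNatAt F a : ℂ) * w z) Set.countable_empty (hball a ha)
    (hw.continuous.const_mul _).continuousOn (fun z _ => (hw z).const_mul _)
  simpa [smul_eq_mul] using this

/-- On the circle `F/F₀` stays within distance `1` of `1`, so the principal logarithm is a
single-valued primitive of the difference of logarithmic derivatives. Integrating the derivative of
`w log(F/F₀)` around the closed circle gives zero. -/
theorem sum_zeros_sub_sum_zeros {F F₀ w : ℂ → ℂ} (hF : Differentiable ℂ F)
    (hF₀ : Differentiable ℂ F₀) (hw : Differentiable ℂ w)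
    (htop : ∀ z, analyticOrderAt F z ≠ ⊤) (htop₀ : ∀ z, analyticOrderAt F₀ z ≠ ⊤)
    {R : ℝ} (hR : 0 < R) {S S₀ : Finset ℂ} (hS : ∀ z, z ∈ S ↔ F z = 0 ∧ ‖z‖ < R)
    (hS₀ : ∀ z, z ∈ S₀ ↔ F₀ z = 0 ∧ ‖z‖ < R)
    (hsph : ∀ z ∈ Metric.sphere (0 : ℂ) R, F z ≠ 0)
    (hsph₀ : ∀ z ∈ Metric.sphere (0 : ℂ) R, F₀ z ≠ 0)
    (hclose : ∀ z ∈ Metric.sphere (0 : ℂ) R, ‖F z / F₀ z - 1‖ < 1) :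
    2 * Real.pi * Complex.I * ((∑ z ∈ S, (analyticOrderNatAt F z : ℂ) * w z) -
      ∑ z ∈ S₀, (analyticOrderNatAt F₀ z : ℂ) * w z) =
      -∮ z in C(0, R), deriv w z * Complex.log (F z / F₀ z) := by
  have hslit : ∀ z ∈ Metric.sphere (0 : ℂ) R, F z / F₀ z ∈ Complex.slitPlane := by
    intro z hz
    have h1 := Complex.mem_slitPlane_of_norm_lt_one (hclose z hz)
    rwa [add_sub_cancel] at h1
  have hL : ∀ z ∈ Metric.sphere (0 : ℂ) R, HasDerivAt (fun z => Complex.log (F z / F₀ z))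
      (logDeriv F z - logDeriv F₀ z) z := by
    intro z hz
    have h1 := ((hF z).hasDerivAt.div (hF₀ z).hasDerivAt (hsph₀ z hz)).clog (hslit z hz)
    refine h1.congr_deriv ?_
    have := hsph z hz
    have := hsph₀ z hz
    rw [logDeriv_apply, logDeriv_apply, Pi.div_apply]
    field_simp
  have hLc : ContinuousOn (fun z => Complex.log (F z / F₀ z)) (Metric.sphere 0 R) :=
    fun z hz => (hL z hz).continuousAt.continuousWithinAt
  have hF' : Continuous (deriv F) := continuous_iff_continuousAt.2 fun z =>
    ((hF.analyticAt z).deriv).continuousAt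
  have hF₀' : Continuous (deriv F₀) := continuous_iff_continuousAt.2 fun z =>
    ((hF₀.analyticAt z).deriv).continuousAt
  have hw' : Continuous (deriv w) := continuous_iff_continuousAt.2 fun z =>
    ((hw.analyticAt z).deriv).continuousAt
  have hi : CircleIntegrable (fun z => w z * logDeriv F z) 0 R :=
    (hw.continuous.continuousOn.mul
      (hF'.continuousOn.div hF.continuous.continuousOn hsph)).circleIntegrable hR.le
  have hi₀ : CircleIntegrable (fun z => w z * logDeriv F₀ z) 0 R :=
    (hw.continuous.continuousOn.mul
      (hF₀'.continuousOn.div hF₀.continuous.continuousOn hsph₀)).circleIntegrable hR.le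
  have hiL : CircleIntegrable (fun z => deriv w z * Complex.log (F z / F₀ z)) 0 R :=
    (hw'.continuousOn.mul hLc).circleIntegrable hR.le
  have h0 := circleIntegral.integral_eq_zero_of_hasDerivWithinAt (c := 0) hR.le
    (f := fun z => w z * Complex.log (F z / F₀ z))
    (fun z hz => ((hw z).hasDerivAt.mul (hL z hz)).hasDerivWithinAt)
  rw [mul_sub, ← circleIntegral_mul_logDeriv hF hw htop hR hS hsph,
    ← circleIntegral_mul_logDeriv hF₀ hw htop₀ hR hS₀ hsph₀,
    ← circleIntegral.integral_sub hi hi₀, eq_neg_iff_add_eq_zero]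
  refine (circleIntegral.integral_add (hi.sub hi₀) hiL).symm.trans (Eq.trans ?_ h0)
  congr 1
  ext z
  simp only [Pi.sub_apply]
  ring

/-! ### Listing the zeros of an entire function by modulus -/

theorem exists_finset_zeros {F : ℂ → ℂ} (hF : Differentiable ℂ F)
    (htop : ∀ z, analyticOrderAt F z ≠ ⊤) (R : ℝ) :
    ∃ S : Finset ℂ, ∀ z, z ∈ S ↔ F z = 0 ∧ ‖z‖ < R := by
  have hfin : {z | F z = 0 ∧ ‖z‖ < R}.Finite := by
    by_contra hinf
    obtain ⟨x, -, hx⟩ := Set.Infinite.exists_accPt_of_subset_isCompact hinf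
      (isCompact_closedBall (0 : ℂ) R) fun z hz => by simpa using hz.2.le
    rcases (hF.analyticAt x).eventually_eq_zero_or_eventually_ne_zero with h | h
    · exact htop x (analyticOrderAt_eq_top.2 h)
    · obtain ⟨y, hy, hy'⟩ := ((accPt_iff_frequently_nhdsNE.1 hx).and_eventually h).exists
      exact hy' hy.1
  exact ⟨hfin.toFinset, by simp⟩

theorem analyticOrderAt_ne_top_of_apply_ne_zero {F : ℂ → ℂ} (hF : Differentiable ℂ F) {a : ℂ}
    (ha : F a ≠ 0) (z : ℂ) : analyticOrderAt F z ≠ ⊤ := by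
  refine AnalyticOnNhd.analyticOrderAt_ne_top_of_isPreconnected (fun z _ => hF.analyticAt z)
    isPreconnected_univ (Set.mem_univ a) (Set.mem_univ z) ?_
  rw [(hF.analyticAt a).analyticOrderAt_eq_zero.2 ha]
  exact ENat.zero_ne_top

/-- Ties of `f` are broken lexicographically by an auxiliary well-order. Each element then has
finitely many predecessors, and counting them embeds `T` in `ℕ` with infinite range, which is
reindexed in increasing order. -/
theorem exists_equiv_nat_monotone {T : Type*} [Infinite T] (f : T → ℝ)
    (hf : ∀ c, {t | f t ≤ c}.Finite) : ∃ e : ℕ ≃ T, Monotone (f ∘ e) := by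
  classical
  let _ : LinearOrder T := linearOrderOfSTO (WellOrderingRel (α := T))
  set g : T → ℝ ×ₗ T := fun t => toLex (f t, t) with hg
  have hginj : Function.Injective g := fun s t h => by
    simpa [hg] using congrArg (fun p => (ofLex p).2) h
  have hgf : ∀ s t, g s ≤ g t → f s ≤ f t := fun s t h => (Prod.Lex.le_iff.1 h).elim
    (fun h => h.le) (fun h => h.1.le)
  have hfin : ∀ t, {s | g s < g t}.Finite := fun t =>
    (hf (f t)).subset fun s hs => hgf s t (le_of_lt hs)
  set r : T → ℕ := fun t => {s | g s < g t}.ncard with hr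
  have hmono : ∀ s t, g s < g t → r s < r t := fun s t h =>
    Set.ncard_lt_ncard ⟨fun u hu => lt_trans hu h, fun hsub => lt_irrefl (g s) (hsub h)⟩ (hfin t)
  have hrinj : Function.Injective r := by
    intro s t h
    by_contra hst
    rcases lt_or_gt_of_ne (hginj.ne hst) with h1 | h1
    · exact (hmono _ _ h1).ne h
    · exact (hmono _ _ h1).ne' h
  have : Infinite (Set.range r) := Set.infinite_coe_iff.2 (Set.infinite_range_of_injective hrinj)
  set o := Nat.Subtype.orderIsoOfNat (Set.range r)
  set E := Equiv.ofInjective r hrinj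
  refine ⟨o.toEquiv.trans E.symm, fun i j hij => hgf _ _ (not_lt.1 fun hlt => ?_)⟩
  have h1 := hmono _ _ hlt
  have h2 : ∀ i, r ((o.toEquiv.trans E.symm) i) = o i := fun i =>
    congrArg Subtype.val (E.apply_symm_apply (o i))
  rw [h2, h2] at h1
  exact absurd (o.monotone hij) (not_le.2 h1)

theorem exists_enumeratesZeros {F : ℂ → ℂ} (hF : Differentiable ℂ F)
    (htop : ∀ z, analyticOrderAt F z ≠ ⊤) (hinf : {z | F z = 0}.Infinite) :
    ∃ μ : ℕ → ℂ, EnumeratesZeros F μ := by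
  set n : ℂ → ℕ := analyticOrderNatAt F
  have hn : ∀ z, F z = 0 → 0 < n z := fun z hz => Nat.pos_of_ne_zero fun h0 => by
    have h1 := Nat.cast_analyticOrderNatAt (htop z)
    rw [show analyticOrderNatAt F z = 0 from h0] at h1
    exact (hF.analyticAt z).analyticOrderAt_ne_zero.2 hz h1.symm
  have hn' : ∀ z, 0 < n z → F z = 0 := fun z hz =>
    apply_eq_zero_of_analyticOrderNatAt_ne_zero hz.ne'
  have : Infinite {z | F z = 0} := Set.infinite_coe_iff.2 hinf
  -- A zero of order `n z` is represented by `n z` copies; fibres over other points are empty.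
  have : Infinite (Σ z, Fin (n z)) :=
    Infinite.of_injective (fun z : {z | F z = 0} => (⟨z.1, ⟨0, hn z.1 z.2⟩⟩ : Σ z, Fin (n z)))
      fun a b h => Subtype.ext (congrArg Sigma.fst h)
  obtain ⟨e, he⟩ := exists_equiv_nat_monotone (fun t : Σ z, Fin (n z) => ‖t.1‖) fun c => by
    obtain ⟨S, hS⟩ := exists_finset_zeros hF htop (c + 1)
    refine (S.sigma fun _ => Finset.univ).finite_toSet.subset fun t ht => ?_
    have ht' : ‖t.1‖ ≤ c := ht
    simpa using (hS t.1).2 ⟨hn' _ t.2.pos, by linarith⟩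
  -- The shift is needed because listings start at index `1`.
  refine ⟨fun j => (e (j - 1)).1, fun z => ?_, fun i j _ hij => he (Nat.sub_le_sub_right hij 1)⟩
  have h1 : {j : ℕ | 1 ≤ j ∧ (e (j - 1)).1 = z} =
      (fun i => i + 1) '' (e.symm '' Set.range (fun i : Fin (n z) => (⟨z, i⟩ : Σ z, Fin (n z)))) := by
    ext j
    constructor
    · rintro ⟨hj, rfl⟩
      exact ⟨j - 1, ⟨e (j - 1), ⟨(e (j - 1)).2, rfl⟩, e.symm_apply_apply _⟩,
        Nat.sub_add_cancel hj⟩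
    · rintro ⟨-, ⟨-, ⟨i, rfl⟩, rfl⟩, rfl⟩
      simp
  have hinj : Function.Injective fun i : Fin (n z) => (⟨z, i⟩ : Σ z, Fin (n z)) :=
    fun i j h => eq_of_heq (Sigma.mk.inj h).2
  rw [h1, (add_left_injective 1).encard_image, e.symm.injective.encard_image, ← Set.image_univ,
    hinj.encard_image, Set.encard_univ, ENat.card_eq_coe_fintype_card,
    Fintype.card_fin]
  exact Nat.cast_analyticOrderNatAt (htop z)

theorem EnumeratesZeros.sum_eq {F : ℂ → ℂ} {μ : ℕ → ℂ} (h : EnumeratesZeros F μ)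
    (htop : ∀ z, analyticOrderAt F z ≠ ⊤) {R : ℝ} {S : Finset ℂ}
    (hS : ∀ z, z ∈ S ↔ F z = 0 ∧ ‖z‖ < R) {N : ℕ} (hN : ∑ z ∈ S, analyticOrderNatAt F z = N) :
    ∑ j ∈ Finset.Icc 1 N, μ j = ∑ z ∈ S, (analyticOrderNatAt F z : ℂ) * z := by
  classical
  have hcard : ∀ z, {j : ℕ | 1 ≤ j ∧ μ j = z}.encard = (analyticOrderNatAt F z : ℕ) := fun z => by
    rw [h.1 z, Nat.cast_analyticOrderNatAt (htop z)]
  have hfin : ∀ z, {j : ℕ | 1 ≤ j ∧ μ j = z}.Finite := fun z =>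
    Set.finite_of_encard_eq_coe (hcard z)
  have hzero : ∀ j, 1 ≤ j → F (μ j) = 0 := fun j hj =>
    apply_eq_zero_of_analyticOrderAt_ne_zero (by
      rw [← h.1]
      exact Set.encard_ne_zero.2 ⟨j, hj, rfl⟩)
  set T : Finset ℕ := S.biUnion fun z => (hfin z).toFinset with hT
  have hmem : ∀ j, j ∈ T ↔ 1 ≤ j ∧ ‖μ j‖ < R := by
    intro j
    simp only [hT, Finset.mem_biUnion, Set.Finite.mem_toFinset, Set.mem_ofPred_eq]
    constructor
    · rintro ⟨z, hz, hj, rfl⟩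
      exact ⟨hj, ((hS _).1 hz).2⟩
    · rintro ⟨hj, hj'⟩
      exact ⟨μ j, (hS _).2 ⟨hzero j hj, hj'⟩, hj, rfl⟩
  have hdisj : (S : Set ℂ).PairwiseDisjoint fun z => (hfin z).toFinset := by
    intro a _ b _ hab
    rw [Function.onFun, Finset.disjoint_left]
    intro j hj hj'
    simp only [Set.Finite.mem_toFinset, Set.mem_ofPred_eq] at hj hj'
    exact hab (hj.2.symm.trans hj'.2)
  have hc : ∀ z, (hfin z).toFinset.card = analyticOrderNatAt F z := fun z => by
    have := hcard z
    rw [(hfin z).encard_eq_coe_toFinset_card] at this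
    exact_mod_cast this
  have hTN : T.card = N := by
    rw [hT, Finset.card_biUnion hdisj, ← hN]
    exact Finset.sum_congr rfl fun z _ => hc z
  -- The indices of zeros inside the disc are closed downwards, since moduli are nondecreasing, and
  -- there are `N` of them.
  have hTIcc : T = Finset.Icc 1 N := by
    refine Finset.eq_of_subset_of_card_le (fun j hj => ?_) (by simp [hTN])
    obtain ⟨hj1, hjR⟩ := (hmem j).1 hj
    have hsub : Finset.Icc 1 j ⊆ T := fun i hi => by
      obtain ⟨hi1, hij⟩ := Finset.mem_Icc.1 hi
      exact (hmem i).2 ⟨hi1, (h.2 i j hi1 hij).trans_lt hjR⟩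
    have := Finset.card_le_card hsub
    rw [Nat.card_Icc, hTN] at this
    exact Finset.mem_Icc.2 ⟨hj1, by omega⟩
  rw [← hTIcc, hT, Finset.sum_biUnion hdisj]
  refine Finset.sum_congr rfl fun z _ => ?_
  rw [Finset.sum_congr rfl fun j hj => ((hfin z).mem_toFinset.1 hj).2, Finset.sum_const, hc,
    nsmul_eq_mul]

/-! ### Comparison with the free problem on large circles -/

/-- The radius `r = |k|` is halfway between the free values `N/2` and `(N+1)/2`, so `2πk` has
modulus `π(N + 1/2)` and dividing by the sine cancels the exponential, at the cost of the factor
`4`. Dividing by `sin/k` also loses one power of `‖k‖`. -/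
theorem norm_hillV_div_sub_le {q : ℝ → ℂ} (hq : ContDiff ℝ 2 q)
    (hQ : ∫ x in (0 : ℝ)..(2 * Real.pi), q x = 0) (hqX : q (2 * Real.pi) = q 0) :
    ∃ C K : ℝ, 0 ≤ C ∧ ∀ N : ℕ, 1 ≤ N → K ≤ N → ∀ r : ℝ, r = (N + 1 / 2) / 2 → ∀ lam : ℂ,
      ‖lam‖ = r ^ 2 → hillV (fun _ => 0) lam (2 * Real.pi) ≠ 0 ∧
        ‖hillV q lam (2 * Real.pi) / hillV (fun _ => 0) lam (2 * Real.pi) - 1 -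
          q 0 / (2 * lam)‖ ≤ C / r ^ 3 := by
  obtain ⟨C, K, hC, hK, h⟩ := hillV_asymptotic hq (by positivity) hQ hqX
  refine ⟨4 * C, 2 * K, by positivity, fun N hN hKN r hr lam hlam => ?_⟩
  have hr0 : 0 < r := by rw [hr]; positivity
  obtain ⟨k, rfl⟩ := IsAlgClosed.exists_pow_nat_eq lam two_pos
  have hkr : ‖k‖ = r := by
    rw [norm_pow] at hlam
    exact (pow_left_inj₀ (norm_nonneg k) hr0.le two_ne_zero).1 hlam
  have hk : k ≠ 0 := norm_pos_iff.1 (hkr ▸ hr0)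
  set z : ℂ := k * (2 * Real.pi : ℝ) with hz
  have hzn : ‖z‖ = Real.pi * (N + 1 / 2) := by
    rw [hz, norm_mul, hkr, Complex.norm_of_nonneg (by positivity), hr]
    ring
  have hzim : |z.im| = |k.im| * (2 * Real.pi) := by
    rw [hz, Complex.im_mul_ofReal, abs_mul, abs_of_nonneg (by positivity : 0 ≤ 2 * Real.pi)]
  have hexp := exp_abs_im_le_norm_sin hN hzn
  have hsin : 0 < ‖Complex.sin z‖ := by linarith [Real.exp_pos |z.im|]
  have hsin0 : Complex.sin z ≠ 0 := norm_pos_iff.1 hsin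
  rw [hillV_zero_sq hk]
  refine ⟨div_ne_zero hsin0 hk, ?_⟩
  have h1 := h k (by rw [hkr, hr]; linarith)
  rw [← hz, ← hzim, hkr] at h1
  have h2 : hillV q (k ^ 2) (2 * Real.pi) / (Complex.sin z / k) - 1 - q 0 / (2 * k ^ 2) =
      (hillV q (k ^ 2) (2 * Real.pi) - (1 + q 0 / (2 * k ^ 2)) * (Complex.sin z / k)) /
        (Complex.sin z / k) := by
    field_simp
    ring
  rw [h2, norm_div, norm_div, hkr, div_le_iff₀ (by positivity)]
  refine h1.trans ?_
  calc C * Real.exp |z.im| / r ^ 4 ≤ C * (4 * ‖Complex.sin z‖) / r ^ 4 := by gcongr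
    _ = _ := by field_simp

theorem mem_image_sq_div_four_iff {N : ℕ} {r : ℝ} (hr : r = (N + 1 / 2) / 2) (z : ℂ) :
    z ∈ (Finset.Icc 1 N).image (fun j : ℕ => (j : ℂ) ^ 2 / 4) ↔
      hillV (fun _ => 0) z (2 * Real.pi) = 0 ∧ ‖z‖ < r ^ 2 := by
  rw [hillV_zero_two_pi_eq_zero_iff, Finset.mem_image]
  have key : ∀ j : ℕ, ‖(j : ℂ) ^ 2 / 4‖ < r ^ 2 ↔ j ≤ N := by
    intro j
    have h1 : ‖(j : ℂ) ^ 2 / 4‖ = ((j : ℝ) / 2) ^ 2 := by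
      rw [norm_div, norm_pow, Complex.norm_natCast, Complex.norm_ofNat]
      ring
    rw [h1, pow_lt_pow_iff_left₀ (by positivity) (by rw [hr]; positivity) two_ne_zero, hr]
    constructor
    · intro h
      have : (j : ℝ) < (N + 1 : ℕ) := by push_cast; linarith
      exact Nat.lt_succ_iff.1 (by exact_mod_cast this)
    · intro h
      have : (j : ℝ) ≤ N := by exact_mod_cast h
      linarith
  constructor
  · rintro ⟨j, hj, rfl⟩
    obtain ⟨hj1, hjN⟩ := Finset.mem_Icc.1 hj
    exact ⟨⟨j, hj1, rfl⟩, (key j).2 hjN⟩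
  · rintro ⟨⟨j, hj1, rfl⟩, hj⟩
    exact ⟨j, Finset.mem_Icc.2 ⟨hj1, (key j).1 hj⟩, rfl⟩

theorem sum_image_sq_div_four (N : ℕ) (w : ℂ → ℂ) :
    ∑ z ∈ (Finset.Icc 1 N).image (fun j : ℕ => (j : ℂ) ^ 2 / 4),
      (analyticOrderNatAt (fun lam => hillV (fun _ => 0) lam (2 * Real.pi)) z : ℂ) * w z =
      ∑ j ∈ Finset.Icc 1 N, w ((j : ℂ) ^ 2 / 4) := by
  rw [Finset.sum_image]
  · refine Finset.sum_congr rfl fun j hj => ?_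
    rw [analyticOrderNatAt, analyticOrderAt_hillV_zero (Finset.mem_Icc.1 hj).1]
    simp
  · intro i _ j _ hij
    have h1 : ((i ^ 2 : ℕ) : ℂ) = (j ^ 2 : ℕ) := by
      push_cast
      linear_combination 4 * hij
    exact Nat.pow_left_injective two_ne_zero (Nat.cast_injective h1)

theorem exists_sum_zeros_hillV {q : ℝ → ℂ} (hq : ContDiff ℝ 2 q)
    (hQ : ∫ x in (0 : ℝ)..(2 * Real.pi), q x = 0) (hqX : q (2 * Real.pi) = q 0) :
    (∀ z, analyticOrderAt (fun lam => hillV q lam (2 * Real.pi)) z ≠ ⊤) ∧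
    ∃ B : ℝ, ∃ N₀ : ℕ, ∀ N ≥ N₀, ∃ R : ℝ, ∃ S : Finset ℂ,
      (∀ z, z ∈ S ↔ hillV q z (2 * Real.pi) = 0 ∧ ‖z‖ < R) ∧
      ∑ z ∈ S, analyticOrderNatAt (fun lam => hillV q lam (2 * Real.pi)) z = N ∧
      ‖(∑ z ∈ S, (analyticOrderNatAt (fun lam => hillV q lam (2 * Real.pi)) z : ℂ) * z) -
        (∑ j ∈ Finset.Icc 1 N, (j : ℂ) ^ 2 / 4) + q 0 / 2‖ ≤ B / N := by
  set F := fun lam => hillV q lam (2 * Real.pi) with hFdef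
  set F₀ := fun lam => hillV (fun _ => 0) lam (2 * Real.pi) with hF₀def
  have hF : Differentiable ℂ F := differentiable_hillV hq.continuous (by positivity)
  have hF₀ : Differentiable ℂ F₀ := differentiable_hillV continuous_const (by positivity)
  obtain ⟨C, K, hC, hrat⟩ := norm_hillV_div_sub_le hq hQ hqX
  set D := ‖q 0‖ / 2 + C with hD
  have hD0 : 0 ≤ D := by positivity
  -- For such `N`, `K` makes the ratio estimate available, `2` gives `r ≥ 1` so that powers of `r`
  -- compare, and `8 * D` gives `D / r² ≤ 1/2`, keeping the logarithm in its Taylor range.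
  obtain ⟨N₀, hN₀⟩ := exists_nat_ge (max (max K 2) (8 * D))
  have main : ∀ N ≥ N₀, ∀ r : ℝ, r = (N + 1 / 2) / 2 → 0 < r ∧
      ∀ lam ∈ Metric.sphere (0 : ℂ) (r ^ 2), F lam ≠ 0 ∧ F₀ lam ≠ 0 ∧
        ‖F lam / F₀ lam - 1‖ < 1 ∧
        ‖Complex.log (F lam / F₀ lam) - q 0 / (2 * lam)‖ ≤ (D ^ 2 + C) / r ^ 3 := by
    intro N hN r hr
    have hNN : max (max K 2) (8 * D) ≤ (N : ℝ) := hN₀.trans (by exact_mod_cast hN)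
    have hK : K ≤ N := (le_max_left _ _).trans ((le_max_left _ _).trans hNN)
    have h2 : (2 : ℝ) ≤ N := (le_max_right _ _).trans ((le_max_left _ _).trans hNN)
    have h8 : 8 * D ≤ N := (le_max_right _ _).trans hNN
    have hr1 : 1 ≤ r := by rw [hr]; linarith
    have hr0 : 0 < r := by linarith
    refine ⟨hr0, fun lam hlam => ?_⟩
    have hl : ‖lam‖ = r ^ 2 := by simpa using hlam
    obtain ⟨hne, hest⟩ := hrat N (by exact_mod_cast (by linarith : (1 : ℝ) ≤ N)) hK r hr lam hl
    change F₀ lam ≠ 0 at hne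
    change ‖F lam / F₀ lam - 1 - q 0 / (2 * lam)‖ ≤ _ at hest
    set h := F lam / F₀ lam - 1 with hh
    have hC3 : C / r ^ 3 ≤ C / r ^ 2 :=
      div_le_div_of_nonneg_left hC (by positivity) (pow_le_pow_right₀ hr1 (by norm_num))
    have hhD : ‖h‖ ≤ D / r ^ 2 := by
      calc ‖h‖ = ‖(h - q 0 / (2 * lam)) + q 0 / (2 * lam)‖ := by rw [sub_add_cancel]
        _ ≤ C / r ^ 2 + ‖q 0‖ / (2 * r ^ 2) := by
            refine (norm_add_le _ _).trans (add_le_add (hest.trans hC3) (le_of_eq ?_))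
            rw [norm_div, norm_mul, hl, Complex.norm_ofNat]
        _ = D / r ^ 2 := by rw [hD]; field_simp; ring
    have hhalf : ‖h‖ ≤ 1 / 2 := by
      refine hhD.trans ?_
      rw [div_le_iff₀ (by positivity)]
      have : (N : ℝ) / 2 ≤ r := by rw [hr]; linarith
      nlinarith
    have hFne : F lam ≠ 0 := by
      intro h0
      rw [hh, h0, zero_div, zero_sub, norm_neg, norm_one] at hhalf
      norm_num at hhalf
    refine ⟨hFne, hne, by linarith, ?_⟩
    have hlog := Complex.norm_log_one_add_sub_self_le (z := h) (by linarith)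
    have hinv : (1 - ‖h‖)⁻¹ ≤ 2 := by
      rw [inv_le_comm₀ (by linarith) two_pos]
      linarith
    have hlog' : ‖Complex.log (1 + h) - h‖ ≤ D ^ 2 / r ^ 3 := by
      calc _ ≤ ‖h‖ ^ 2 * (1 - ‖h‖)⁻¹ / 2 := hlog
        _ ≤ ‖h‖ ^ 2 * 2 / 2 := by gcongr
        _ = ‖h‖ ^ 2 := by ring
        _ ≤ (D / r ^ 2) ^ 2 := by gcongr
        _ = D ^ 2 / r ^ 4 := by field_simp
        _ ≤ D ^ 2 / r ^ 3 := div_le_div_of_nonneg_left (by positivity) (by positivity)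
            (pow_le_pow_right₀ hr1 (by norm_num))
    have e1 : F lam / F₀ lam = 1 + h := by rw [hh]; ring
    rw [e1]
    calc ‖Complex.log (1 + h) - q 0 / (2 * lam)‖ =
          ‖(Complex.log (1 + h) - h) + (h - q 0 / (2 * lam))‖ := by congr 1; ring
      _ ≤ D ^ 2 / r ^ 3 + C / r ^ 3 := (norm_add_le _ _).trans (add_le_add hlog' hest)
      _ = _ := by ring
  have hpt : ∃ a, F a ≠ 0 ∧ F₀ a ≠ 0 := by
    obtain ⟨hr, h⟩ := main N₀ le_rfl _ rfl
    refine ⟨(((((N₀ : ℝ) + 1 / 2) / 2) ^ 2 : ℝ) : ℂ), ?_⟩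
    obtain ⟨h1, h2, -⟩ := h (((((N₀ : ℝ) + 1 / 2) / 2) ^ 2 : ℝ) : ℂ) (by
      rw [mem_sphere_zero_iff_norm, Complex.norm_of_nonneg (by positivity)])
    exact ⟨h1, h2⟩
  obtain ⟨a, ha, ha₀⟩ := hpt
  have htop := analyticOrderAt_ne_top_of_apply_ne_zero hF ha
  have htop₀ := analyticOrderAt_ne_top_of_apply_ne_zero hF₀ ha₀
  refine ⟨htop, 2 * (D ^ 2 + C), max N₀ 1, fun N hN => ?_⟩
  have hN1 : 1 ≤ N := (le_max_right _ _).trans hN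
  obtain ⟨hr0, hm⟩ := main N ((le_max_left _ _).trans hN) _ rfl
  set r : ℝ := (N + 1 / 2) / 2 with hr
  obtain ⟨S, hS⟩ := exists_finset_zeros hF htop (r ^ 2)
  have hR : 0 < r ^ 2 := by positivity
  have hcmp : ∀ w : ℂ → ℂ, Differentiable ℂ w →
      2 * Real.pi * Complex.I * ((∑ z ∈ S, (analyticOrderNatAt F z : ℂ) * w z) -
        ∑ j ∈ Finset.Icc 1 N, w ((j : ℂ) ^ 2 / 4)) =
        -∮ z in C(0, r ^ 2), deriv w z * Complex.log (F z / F₀ z) := fun w hw => by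
    rw [← sum_image_sq_div_four]
    exact sum_zeros_sub_sum_zeros hF hF₀ hw htop htop₀ hR hS (mem_image_sq_div_four_iff hr)
      (fun z hz => (hm z hz).1) (fun z hz => (hm z hz).2.1) (fun z hz => (hm z hz).2.2.1)
  refine ⟨r ^ 2, S, hS, ?_, ?_⟩
  -- A constant weight makes the contour integral vanish, so the zero counts agree, as in Rouché's
  -- theorem.
  · have h1 := hcmp (fun _ => 1) (differentiable_const _)
    simp only [deriv_const, zero_mul, mul_one, Finset.sum_const, Nat.card_Icc, Nat.add_sub_cancel,
      nsmul_eq_mul] at h1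
    have h2 : (∮ _z in C(0, r ^ 2), (0 : ℂ)) = 0 := by simp [circleIntegral]
    rw [h2, neg_zero, mul_eq_zero, or_iff_right (by simp [Real.pi_ne_zero]), sub_eq_zero] at h1
    exact_mod_cast h1
  · have h1 := hcmp (fun z => z) differentiable_id
    simp only [deriv_id'', one_mul] at h1
    have hsne : ∀ z ∈ Metric.sphere (0 : ℂ) (r ^ 2), z ≠ 0 := fun z hz =>
      norm_pos_iff.1 (by rw [mem_sphere_zero_iff_norm.1 hz]; exact hR)
    have hlogc : ContinuousOn (fun z => Complex.log (F z / F₀ z))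
        (Metric.sphere (0 : ℂ) (r ^ 2)) := by
      refine (hF.continuous.continuousOn.div hF₀.continuous.continuousOn
        fun z hz => (hm z hz).2.1).clog fun z hz => ?_
      have h2 := Complex.mem_slitPlane_of_norm_lt_one (hm z hz).2.2.1
      rwa [add_sub_cancel] at h2
    have hqc : ContinuousOn (fun z => q 0 / (2 * z)) (Metric.sphere (0 : ℂ) (r ^ 2)) :=
      continuousOn_const.div (by fun_prop) fun z hz => mul_ne_zero two_ne_zero (hsne z hz)
    have hint : (∮ z in C(0, r ^ 2), q 0 / (2 * z)) = 2 * Real.pi * Complex.I * (q 0 / 2) := by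
      have h2 := circleIntegral.integral_sub_inv_of_mem_ball (c := 0) (w := 0) (R := r ^ 2)
        (by simpa using hR)
      have h3 : (fun z : ℂ => q 0 / (2 * z)) = fun z => q 0 / 2 * (z - 0)⁻¹ := by
        ext z
        rw [sub_zero, div_mul_eq_div_div, div_eq_mul_inv]
      rw [h3, circleIntegral.integral_const_mul, h2]
      ring
    have hb := circleIntegral.norm_integral_le_of_norm_le_const hR.le
      fun z hz => (hm z hz).2.2.2
    rw [circleIntegral.integral_sub (hlogc.circleIntegrable hR.le) (hqc.circleIntegrable hR.le),
      hint] at hb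
    set A := (∑ z ∈ S, (analyticOrderNatAt F z : ℂ) * z) - ∑ j ∈ Finset.Icc 1 N, (j : ℂ) ^ 2 / 4
    set J := ∮ z in C(0, r ^ 2), Complex.log (F z / F₀ z)
    have h4 : J - 2 * Real.pi * Complex.I * (q 0 / 2) =
        -(2 * Real.pi * Complex.I) * (A + q 0 / 2) := by
      linear_combination h1
    have h5 : ‖-(2 * (Real.pi : ℂ) * Complex.I)‖ = 2 * Real.pi := by
      rw [norm_neg, norm_mul, norm_mul, Complex.norm_I, Complex.norm_ofNat,
        Complex.norm_of_nonneg Real.pi_pos.le, mul_one]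
    rw [h4, norm_mul, h5, mul_assoc (2 * Real.pi)] at hb
    have h6 := le_of_mul_le_mul_left hb (by positivity)
    have hN0 : (0 : ℝ) < N := by exact_mod_cast hN1
    calc ‖A + q 0 / 2‖ ≤ r ^ 2 * ((D ^ 2 + C) / r ^ 3) := h6
      _ = (D ^ 2 + C) / r := by field_simp
      _ ≤ (D ^ 2 + C) / (N / 2) := by
          refine div_le_div_of_nonneg_left (by positivity) (by positivity) ?_
          rw [hr]
          linarith
      _ = _ := by field_simp

theorem mainTheorem2 (q : ℝ → ℂ) (hq : ContDiff ℝ 2 q)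
    (hper : Function.Periodic q (2 * Real.pi)) (hmean : hillMean q = 0) :
    AnalyticOnNhd ℂ (fun lam : ℂ => hillV q lam (2 * Real.pi)) Set.univ ∧
    (∃ μ : ℕ → ℂ, EnumeratesZeros (fun lam : ℂ => hillV q lam (2 * Real.pi)) μ) ∧
    ∀ μ : ℕ → ℂ, EnumeratesZeros (fun lam : ℂ => hillV q lam (2 * Real.pi)) μ →
      Tendsto (fun n : ℕ => ∑ j ∈ Finset.Icc 1 n, (μ j - (j : ℂ) ^ 2 / 4)) atTop
        (𝓝 (-q 0 / 2)) := by
  have hF : Differentiable ℂ fun lam => hillV q lam (2 * Real.pi) :=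
    differentiable_hillV hq.continuous (by positivity)
  have hQ : ∫ x in (0 : ℝ)..(2 * Real.pi), q x = 0 := by
    rw [hillMean, mul_eq_zero] at hmean
    exact hmean.resolve_left (by simp [Real.pi_ne_zero])
  have hqX : q (2 * Real.pi) = q 0 := by simpa using hper 0
  obtain ⟨htop, B, N₀, hsum⟩ := exists_sum_zeros_hillV hq hQ hqX
  refine ⟨fun z _ => hF.analyticAt z, exists_enumeratesZeros hF htop fun hfin => ?_,
    fun μ hμ => ?_⟩
  -- If the zero set were finite, its total multiplicity `m` would bound the count in every disc,
  -- yet some disc contains at least `m + 1` zeros.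
  · set T := hfin.toFinset
    set m := ∑ z ∈ T, analyticOrderNatAt (fun lam => hillV q lam (2 * Real.pi)) z
    obtain ⟨R, S, hS, hcard, -⟩ := hsum (max N₀ (m + 1)) (le_max_left _ _)
    have hST : S ⊆ T := fun z hz => hfin.mem_toFinset.2 ((hS z).1 hz).1
    have h1 := Finset.sum_le_sum_of_subset (f := fun z =>
      analyticOrderNatAt (fun lam => hillV q lam (2 * Real.pi)) z) hST
    rw [hcard] at h1
    have h2 := (le_max_right N₀ (m + 1)).trans h1
    omega
  · rw [tendsto_iff_norm_sub_tendsto_zero]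
    refine squeeze_zero' (Eventually.of_forall fun _ => norm_nonneg _) ?_
      (tendsto_const_div_atTop_nhds_zero_nat B)
    filter_upwards [eventually_ge_atTop N₀] with N hN
    obtain ⟨R, S, hS, hcard, hb⟩ := hsum N hN
    rw [Finset.sum_sub_distrib, hμ.sum_eq htop hS hcard, neg_div, sub_neg_eq_add]
    exact hb
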